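/- Let $(X,d)$ be a complete CAT(0) space, that is, a complete metric space in which any two points are joined by a geodesic and every geodesic triangle is at least as thin as its comparison triangle in the Euclidean plane. For $x,y\in X$ and $t\in[0,1]$ write $(1-t)x+ty$ for the unique point $z$ of the geodesic segment joining $x$ and $y$ with $d(x,z)=t\,d(x,y)$. Let $C\subseteq X$ be nonempty, closed and convex (that is, $(1-t)x+ty\in C$ for all $x,y\in C$ and $t\in[0,1]$), and let $T:C\to C$ be nonexpansive, i.e. $d(Tx,Ty)\le d(x,y)$ for all $x,y\in C$, with $\mathrm{Fix}(T)=\{p\in C: Tp=p\}\neq\emptyset$. Let $(\beta_n)_{n\ge 0}$ and $(\lambda_n)_{n\ge 0}$ be sequences in $[0,1]$ such that (C1) $\sum_{n=0}^\infty(1-\beta_n)=\infty$, (C2) $\sum_{n=0}^\infty|\beta_{n+1}-\beta_n|<\infty$, (C3) $\sum_{n=0}^\infty|\lambda_{n+1}-\lambda_n|<\infty$, (C4) $\lim_{n\to\infty}\beta_n=1$, (C5) $\liminf_{n\to\infty}\lambda_n>0$. Let $u,x_0\in C$ and let $(x_n)$ be the Tikhonov-Mann iteration $$u_n=(1-\beta_n)u+\beta_n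 x_n,\qquad x_{n+1}=(1-\lambda_n)u_n+\lambda_n Tu_n\qquad(n\ge 0).$$ Then $(x_n)$ converges (in the metric $d$) to a fixed point $p$ of $T$, and $p$ is a point of $\mathrm{Fix}(T)$ nearest to $u$: $d(u,p)\le d(u,q)$ for all $q\in\mathrm{Fix}(T)$. -/

import Mathlib

open Filter Topology

/-- `γ`, restricted to `[0, d(x,y)]`, is a geodesic path joining `x` to `y`. -/
def IsGeodesicPath {X : Type*} [MetricSpace X] (γ : ℝ → X) (x y : X) : Prop :=
  γ 0 = x ∧ γ (dist x y) = y ∧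
    ∀ s ∈ Set.Icc 0 (dist x y), ∀ t ∈ Set.Icc 0 (dist x y), dist (γ s) (γ t) = |s - t|

/-- `S` is a geodesic segment with endpoints `x` and `y`. -/
def IsGeodesicSegment {X : Type*} [MetricSpace X] (S : Set X) (x y : X) : Prop :=
  ∃ γ : ℝ → X, IsGeodesicPath γ x y ∧ S = γ '' Set.Icc 0 (dist x y)

/-- A CAT(0) space: a geodesic metric space in which every geodesic triangle is at least as thin
as its comparison triangle in the Euclidean plane. Any two distinct sides of a triangle share a
vertex, called `p` below (for two points on one side the inequality is automatic), and the
third side plays no role in the inequality. -/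
class CAT0Space (X : Type*) [MetricSpace X] : Prop where
  exists_geodesic : ∀ x y : X, ∃ γ : ℝ → X, IsGeodesicPath γ x y
  comparison : ∀ (p q r : X) (S S' : Set X), IsGeodesicSegment S p q → IsGeodesicSegment S' p r →
    ∀ p' q' r' : EuclideanSpace ℝ (Fin 2),
      dist p' q' = dist p q → dist p' r' = dist p r → dist q' r' = dist q r →
    ∀ x ∈ S, ∀ y ∈ S', ∀ x' ∈ segment ℝ p' q', ∀ y' ∈ segment ℝ p' r',
      dist p' x' = dist p x → dist p' y' = dist p y → dist x y ≤ dist x' y'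

/-- For `t ∈ [0,1]`, the convex combination `(1 - t) x + t y` in a CAT(0) space: the point at
distance `t d(x,y)` from `x` on the geodesic joining `x` to `y`. -/
noncomputable def geoComb {X : Type*} [MetricSpace X] [CAT0Space X] (x y : X) (t : ℝ) : X :=
  (CAT0Space.exists_geodesic x y).choose (t * dist x y)

/-- `geoComb` does not depend on the chosen geodesic: geodesics in CAT(0) spaces are unique. -/
theorem IsGeodesicPath.apply_eq_geoComb {X : Type*} [MetricSpace X] [CAT0Space X] {γ : ℝ → X}
    {x y : X} (h : IsGeodesicPath γ x y) {t : ℝ} (ht : t ∈ Set.Icc (0 : ℝ) 1) :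
    γ (t * dist x y) = geoComb x y t := by
  have h' := (CAT0Space.exists_geodesic x y).choose_spec
  set η := (CAT0Space.exists_geodesic x y).choose with hη
  have hd : (0 : ℝ) ≤ dist x y := dist_nonneg
  have hm : t * dist x y ∈ Set.Icc 0 (dist x y) :=
    ⟨mul_nonneg ht.1 hd, mul_le_of_le_one_left hd ht.2⟩
  have hdist : ∀ {δ : ℝ → X}, IsGeodesicPath δ x y → dist x (δ (t * dist x y)) = t * dist x y := by
    intro δ hδ
    have := hδ.2.2 0 ⟨le_rfl, hd⟩ _ hm
    rw [hδ.1] at this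
    rw [this, zero_sub, abs_neg, abs_of_nonneg hm.1]
  have hq : dist (0 : EuclideanSpace ℝ (Fin 2)) (EuclideanSpace.single 0 (dist x y)) = dist x y := by
    simp [dist_eq_norm]
  have hz : dist (0 : EuclideanSpace ℝ (Fin 2)) (t • EuclideanSpace.single 0 (dist x y))
      = t * dist x y := by
    rw [dist_zero_left, norm_smul, Real.norm_of_nonneg ht.1]
    simp
  have hseg : t • EuclideanSpace.single 0 (dist x y) ∈
      segment ℝ (0 : EuclideanSpace ℝ (Fin 2)) (EuclideanSpace.single 0 (dist x y)) :=
    ⟨1 - t, t, sub_nonneg.2 ht.2, ht.1, by ring, by simp⟩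
  have key := CAT0Space.comparison x y y _ _ ⟨γ, h, rfl⟩ ⟨η, h', rfl⟩ 0
    (EuclideanSpace.single 0 (dist x y)) (EuclideanSpace.single 0 (dist x y)) hq hq (by simp)
    _ ⟨_, hm, rfl⟩ _ ⟨_, hm, rfl⟩ _ hseg _ hseg (hz.trans (hdist h).symm) (hz.trans (hdist h').symm)
  rw [dist_self] at key
  exact dist_le_zero.1 key

/-- A convex subset of a CAT(0) space (convex sets are nonempty by convention). -/
def GeoConvex {X : Type*} [MetricSpace X] [CAT0Space X] (C : Set X) : Prop :=
  C.Nonempty ∧ ∀ x ∈ C, ∀ y ∈ C, ∀ t ∈ Set.Icc (0 : ℝ) 1, geoComb x y t ∈ C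

/-- The Tikhonov-Mann iteration: `u_n = (1 - β_n) u + β_n x_n` and
`x_{n+1} = (1 - l_n) u_n + l_n T u_n`. -/
noncomputable def tikhonovMann {X : Type*} [MetricSpace X] [CAT0Space X] (T : X → X)
    (β l : ℕ → ℝ) (u x₀ : X) : ℕ → X
  | 0 => x₀
  | n + 1 =>
      let un := geoComb u (tikhonovMann T β l u x₀ n) (β n)
      geoComb un (T un) (l n)

/-!
The comparison axiom gives two facts about convex combinations: the Bruhat–Tits inequality
`dist_geoComb_sq_le`, which says that squared distances are uniformly convex along geodesics, and
the joint convexity of the metric, `dist_geoComb_le`.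

The limit is constructed without resolvents or projections. Let `δ` be the limit, as `ε → 0`, of
the infimum of `dist u` over the points of `C` moved by at most `ε` under `T`. Midpoints of
approximate fixed points are again approximate fixed points (`dist_midpoint_apply_sq_le`), so
uniform convexity makes every sequence of approximate fixed points whose distance to `u` tends to
at most `δ` a Cauchy sequence. Its limit `p` is a fixed point with `dist u p = δ`. Hence `p` is a
nearest fixed point, and `liminf dist u (y n) ≥ dist u p` holds along *every* sequence `y` in `C`
with `dist (y n) (T (y n)) → 0` (`exists_fixedPoint_forall_approx`).

The iterates `x n` form such a sequence. Indeed consecutive steps satisfy a recursive inequality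
with damping factors `β (n + 1)` and a summable perturbation
(`dist_tikhonovMann_succ_succ_le`), so they tend to zero by Xu's lemma
`tendsto_zero_of_le_one_sub_mul_add`, and `β → 1`, `liminf l > 0` turn this into
`dist (x n) (T (x n)) → 0` (`tendsto_dist_tikhonovMann_apply`).

Finally, the Bruhat–Tits inequality yields
`dist (x (n + 1)) p ^ 2 ≤ β n * dist (x n) p ^ 2 + (1 - β n) * b n` with
`b n = dist u p ^ 2 - β n * dist u (x n) ^ 2`. The property of `p` above says `limsup b ≤ 0`, so
Xu's lemma applies once more and gives `x n → p`.
-/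

/-! ### Geometry of convex combinations -/

/-- Every triple of points of a metric space has a comparison triangle in the Euclidean plane. -/
theorem exists_comparison_triangle {X : Type*} [MetricSpace X] (x y z : X) :
    ∃ x' y' z' : EuclideanSpace ℝ (Fin 2),
      dist x' y' = dist x y ∧ dist x' z' = dist x z ∧ dist y' z' = dist y z := by
  have ha : 0 ≤ dist x y := dist_nonneg
  have hc : 0 ≤ dist x z := dist_nonneg
  have hb : 0 ≤ dist y z := dist_nonneg
  have h1 := dist_triangle x y z
  have h2 := dist_triangle y x z
  have h3 := dist_triangle x z y
  rw [dist_comm y x] at h2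
  rw [dist_comm z y] at h3
  rcases eq_or_lt_of_le ha with h0 | h0
  · have hxy : x = y := dist_eq_zero.1 h0.symm
    subst hxy
    exact ⟨0, 0, EuclideanSpace.single 0 (dist x z), by simp, by simp [dist_eq_norm],
      by simp [dist_eq_norm]⟩
  · set a := dist x y
    set b := dist y z
    set c := dist x z
    -- the law of cosines determines the first coordinate of the third vertex
    set r := (a ^ 2 + c ^ 2 - b ^ 2) / (2 * a) with hr
    have hra : 2 * a * r = a ^ 2 + c ^ 2 - b ^ 2 := by rw [hr]; field_simp
    have hrc : r ≤ c := by
      rw [hr, div_le_iff₀ (by positivity)]; nlinarith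
    have hrc' : -c ≤ r := by
      rw [hr, le_div_iff₀ (by positivity)]; nlinarith
    have hs : 0 ≤ c ^ 2 - r ^ 2 := by nlinarith
    have hsq := Real.sq_sqrt hs
    refine ⟨0, !₂[a, 0], !₂[r, √(c ^ 2 - r ^ 2)], ?_, ?_, ?_⟩
    · rw [dist_zero_left, EuclideanSpace.norm_eq]
      simp [Real.sqrt_sq h0.le]
    · rw [dist_zero_left, EuclideanSpace.norm_eq]
      simp [hsq, Real.sqrt_sq hc]
    · rw [EuclideanSpace.dist_eq]
      have : (a - r) ^ 2 + √(c ^ 2 - r ^ 2) ^ 2 = b ^ 2 := by rw [hsq]; linarith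
      simp [Real.dist_eq, sq_abs]
      rw [← Real.sqrt_sq hb, ← this]

theorem mul_dist_mem_Icc {X : Type*} [MetricSpace X] (x y : X) {t : ℝ}
    (ht : t ∈ Set.Icc (0 : ℝ) 1) :
    t * dist x y ∈ Set.Icc 0 (dist x y) :=
  ⟨mul_nonneg ht.1 dist_nonneg, mul_le_of_le_one_left dist_nonneg ht.2⟩

section CAT0

variable {X : Type*} [MetricSpace X] [CAT0Space X]

theorem isGeodesicPath_choose (x y : X) :
    IsGeodesicPath (CAT0Space.exists_geodesic x y).choose x y :=
  (CAT0Space.exists_geodesic x y).choose_spec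

theorem dist_geoComb_geoComb (x y : X) {s t : ℝ} (hs : s ∈ Set.Icc (0 : ℝ) 1)
    (ht : t ∈ Set.Icc (0 : ℝ) 1) :
    dist (geoComb x y s) (geoComb x y t) = |s - t| * dist x y := by
  have h := (isGeodesicPath_choose x y).2.2 _ (mul_dist_mem_Icc x y hs) _
    (mul_dist_mem_Icc x y ht)
  rw [← sub_mul, abs_mul, abs_of_nonneg (dist_nonneg (x := x) (y := y))] at h
  exact h

theorem geoComb_zero (x y : X) : geoComb x y 0 = x := by
  have h := (isGeodesicPath_choose x y).1
  simpa [geoComb] using h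

theorem geoComb_one (x y : X) : geoComb x y 1 = y := by
  have h := (isGeodesicPath_choose x y).2.1
  simpa [geoComb] using h

theorem dist_left_geoComb (x y : X) {t : ℝ} (ht : t ∈ Set.Icc (0 : ℝ) 1) :
    dist x (geoComb x y t) = t * dist x y := by
  have h := dist_geoComb_geoComb x y (s := 0) ⟨le_rfl, zero_le_one⟩ ht
  rwa [geoComb_zero, zero_sub, abs_neg, abs_of_nonneg ht.1] at h

theorem dist_geoComb_right (x y : X) {t : ℝ} (ht : t ∈ Set.Icc (0 : ℝ) 1) :
    dist (geoComb x y t) y = (1 - t) * dist x y := by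
  have h := dist_geoComb_geoComb x y (t := 1) ht ⟨zero_le_one, le_rfl⟩
  rwa [geoComb_one, abs_sub_comm, abs_of_nonneg (sub_nonneg.2 ht.2)] at h

theorem geoComb_symm (x y : X) {t : ℝ} (ht : t ∈ Set.Icc (0 : ℝ) 1) :
    geoComb x y t = geoComb y x (1 - t) := by
  have hγ := isGeodesicPath_choose x y
  set γ := (CAT0Space.exists_geodesic x y).choose with hdef
  have hrev : IsGeodesicPath (fun s => γ (dist x y - s)) y x := by
    refine ⟨by simpa using hγ.2.1, by simpa [dist_comm y x] using hγ.1, fun s hs r hr => ?_⟩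
    rw [dist_comm y x] at hs hr
    rw [hγ.2.2 _ ⟨by linarith [hs.2], by linarith [hs.1]⟩ _
      ⟨by linarith [hr.2], by linarith [hr.1]⟩, abs_sub_comm]
    congr 1
    ring
  have h := hrev.apply_eq_geoComb (t := 1 - t) ⟨by linarith [ht.2], by linarith [ht.1]⟩
  rw [← h]
  change γ (t * dist x y) = γ (dist x y - (1 - t) * dist y x)
  rw [dist_comm y x]
  congr 1
  ring

/-- The comparison inequality for the points with parameters `s` and `t` on two sides of a
triangle. -/
theorem exists_comparison_dist_le (p q r : X) :
    ∃ q' r' : EuclideanSpace ℝ (Fin 2),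
      ‖q'‖ = dist p q ∧ ‖r'‖ = dist p r ∧ ‖q' - r'‖ = dist q r ∧
      ∀ s ∈ Set.Icc (0 : ℝ) 1, ∀ t ∈ Set.Icc (0 : ℝ) 1,
        dist (geoComb p q s) (geoComb p r t) ≤ ‖s • q' - t • r'‖ := by
  obtain ⟨p', q', r', hq, hr, hqr⟩ := exists_comparison_triangle p q r
  refine ⟨q' - p', r' - p', ?_, ?_, ?_, fun s hs t ht => ?_⟩
  · rw [← dist_eq_norm, dist_comm, hq]
  · rw [← dist_eq_norm, dist_comm, hr]
  · rw [sub_sub_sub_cancel_right, ← dist_eq_norm, hqr]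
  · have hseg : ∀ (v : EuclideanSpace ℝ (Fin 2)) {a : ℝ}, a ∈ Set.Icc (0 : ℝ) 1 →
        p' + a • (v - p') ∈ segment ℝ p' v := fun v a ha =>
      ⟨1 - a, a, sub_nonneg.2 ha.2, ha.1, by ring, by module⟩
    have hd : ∀ (v : EuclideanSpace ℝ (Fin 2)) {a : ℝ}, a ∈ Set.Icc (0 : ℝ) 1 →
        dist p' (p' + a • (v - p')) = a * dist p' v := fun v a ha => by
      rw [dist_self_add_right, norm_smul, Real.norm_of_nonneg ha.1, ← dist_eq_norm, dist_comm]
    have h := CAT0Space.comparison p q r _ _ ⟨_, isGeodesicPath_choose p q, rfl⟩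
      ⟨_, isGeodesicPath_choose p r, rfl⟩ p' q' r' hq hr hqr
      _ ⟨_, mul_dist_mem_Icc p q hs, rfl⟩ _ ⟨_, mul_dist_mem_Icc p r ht, rfl⟩
      _ (hseg q' hs) _ (hseg r' ht)
      (by rw [hd q' hs, hq]; exact (dist_left_geoComb p q hs).symm)
      (by rw [hd r' ht, hr]; exact (dist_left_geoComb p r ht).symm)
    rwa [dist_add_left, dist_eq_norm] at h

/-- The Bruhat–Tits inequality: squared distance functions are uniformly convex along
geodesics. -/
theorem dist_geoComb_sq_le (x y w : X) {t : ℝ} (ht : t ∈ Set.Icc (0 : ℝ) 1) :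
    dist (geoComb x y t) w ^ 2 ≤
      (1 - t) * dist x w ^ 2 + t * dist y w ^ 2 - t * (1 - t) * dist x y ^ 2 := by
  obtain ⟨y', w', hy, hw, hyw, h⟩ := exists_comparison_dist_le x y w
  have h1 := h t ht 1 ⟨zero_le_one, le_rfl⟩
  rw [geoComb_one, one_smul] at h1
  have h2 := pow_le_pow_left₀ dist_nonneg h1 2
  rw [norm_sub_sq_real, norm_smul, inner_smul_left, mul_pow, Real.norm_eq_abs, sq_abs] at h2
  have h3 := norm_sub_sq_real y' w'
  rw [hy, hw, hyw] at h3
  rw [hy, hw] at h2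
  simp only [conj_trivial] at h2
  rw [h3]
  linarith

theorem dist_geoComb_le_of_left_eq (x y y' : X) {t : ℝ} (ht : t ∈ Set.Icc (0 : ℝ) 1) :
    dist (geoComb x y t) (geoComb x y' t) ≤ t * dist y y' := by
  obtain ⟨q', r', -, -, hqr, h⟩ := exists_comparison_dist_le x y y'
  have h1 := h t ht t ht
  rwa [← smul_sub, norm_smul, Real.norm_of_nonneg ht.1, hqr] at h1

theorem dist_geoComb_le (x y x' y' : X) {t : ℝ} (ht : t ∈ Set.Icc (0 : ℝ) 1) :
    dist (geoComb x y t) (geoComb x' y' t) ≤ (1 - t) * dist x x' + t * dist y y' := by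
  have h1 := dist_geoComb_le_of_left_eq x y y' ht
  have h2 := dist_geoComb_le_of_left_eq y' x x' (t := 1 - t)
    ⟨by linarith [ht.2], by linarith [ht.1]⟩
  rw [← geoComb_symm x y' ht, ← geoComb_symm x' y' ht] at h2
  linarith [dist_triangle (geoComb x y t) (geoComb x y' t) (geoComb x' y' t)]

theorem dist_geoComb_le_right (x y w : X) {t : ℝ} (ht : t ∈ Set.Icc (0 : ℝ) 1) :
    dist (geoComb x y t) w ≤ (1 - t) * dist x w + t * dist y w := by
  have h := dist_geoComb_le x y w w ht
  have hw : geoComb w w t = w := by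
    have := dist_left_geoComb w w ht
    rw [dist_self, mul_zero] at this
    exact (dist_eq_zero.1 this).symm
  rwa [hw] at h

end CAT0

/-! ### Recursive inequalities for real sequences -/

/-- Xu's lemma: the damping factors `1 - a n` with `∑ a n = ∞` drive `s` to zero, in spite of a
summable perturbation `c` and of a perturbation `a * b` with `limsup b ≤ 0`. -/
theorem tendsto_zero_of_le_one_sub_mul_add {s a b c : ℕ → ℝ} (hs : ∀ n, 0 ≤ s n)
    (ha : ∀ n, a n ∈ Set.Icc (0 : ℝ) 1)
    (hsum : Tendsto (fun N => ∑ n ∈ Finset.range N, a n) atTop atTop)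
    (hb : ∀ η > 0, ∀ᶠ n in atTop, b n ≤ η) (hc0 : ∀ n, 0 ≤ c n) (hc : Summable c)
    (h : ∀ n, s (n + 1) ≤ (1 - a n) * s n + a n * b n + c n) :
    Tendsto s atTop (𝓝 0) := by
  have hprod : ∀ N, Tendsto (fun k => ∏ i ∈ Finset.range k, (1 - a (N + i))) atTop (𝓝 0) := by
    intro N
    have h1 : Tendsto (fun k => ∑ i ∈ Finset.range k, a (N + i)) atTop atTop := by
      have h2 : Tendsto (fun k => ∑ n ∈ Finset.range (N + k), a n) atTop atTop := by
        have := (tendsto_add_atTop_iff_nat (f := fun N => ∑ n ∈ Finset.range N, a n) N).2 hsum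
        simpa [add_comm] using this
      have h3 := tendsto_atTop_add_const_left _ (-∑ n ∈ Finset.range N, a n) h2
      refine h3.congr fun k => ?_
      rw [Finset.sum_range_add]
      ring
    refine squeeze_zero (fun k => Finset.prod_nonneg fun i _ => sub_nonneg.2 (ha _).2) (fun k => ?_)
      (Real.tendsto_exp_atBot.comp (tendsto_neg_atTop_atBot.comp h1))
    simp only [Function.comp, ← Finset.sum_neg_distrib, Real.exp_sum]
    refine Finset.prod_le_prod (fun i _ => sub_nonneg.2 (ha _).2) fun i _ => ?_
    have := Real.add_one_le_exp (-a (N + i))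
    linarith
  rw [Metric.tendsto_atTop]
  intro ε hε
  have htail := tendsto_sum_nat_add c
  obtain ⟨N, hNb, hNc⟩ : ∃ N, (∀ n ≥ N, b n ≤ ε / 3) ∧ ∑' i, c (i + N) < ε / 3 := by
    obtain ⟨N₁, h₁⟩ := eventually_atTop.1 (hb (ε / 3) (by positivity))
    obtain ⟨N₂, h₂⟩ := eventually_atTop.1 (htail.eventually (gt_mem_nhds (by positivity : 0 < ε / 3)))
    exact ⟨max N₁ N₂, fun n hn => h₁ n (le_trans (le_max_left _ _) hn), h₂ _ (le_max_right _ _)⟩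
  have key : ∀ k, s (N + k) ≤
      ε / 3 + ∑ i ∈ Finset.range k, c (i + N) + (∏ i ∈ Finset.range k, (1 - a (N + i))) * s N := by
    intro k
    induction k with
    | zero => simp; positivity
    | succ k ih =>
      have hk := h (N + k)
      rw [Finset.sum_range_succ, Finset.prod_range_succ, add_comm k N]
      have ha' := ha (N + k)
      have hC : 0 ≤ ∑ i ∈ Finset.range k, c (i + N) := Finset.sum_nonneg fun i _ => hc0 _
      have e1 := mul_le_mul_of_nonneg_left ih (sub_nonneg.2 ha'.2)
      have e2 := mul_le_mul_of_nonneg_left (hNb (N + k) (by omega)) ha'.1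
      have e3 := mul_nonneg ha'.1 hC
      rw [← add_assoc]
      nlinarith
  have hlim : Tendsto (fun k => (∏ i ∈ Finset.range k, (1 - a (N + i))) * s N) atTop (𝓝 0) := by
    simpa using (hprod N).mul_const (s N)
  obtain ⟨K, hK⟩ := eventually_atTop.1 (hlim.eventually (gt_mem_nhds (by positivity : 0 < ε / 3)))
  refine ⟨N + K, fun n hn => ?_⟩
  obtain ⟨k, rfl⟩ := Nat.exists_eq_add_of_le (le_trans (Nat.le_add_right N K) hn)
  have hs1 : ∑ i ∈ Finset.range k, c (i + N) ≤ ∑' i, c (i + N) :=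
    ((summable_nat_add_iff N).2 hc).sum_le_tsum _ fun i _ => hc0 _
  have := key k
  have := hK k (by omega)
  rw [Real.dist_eq, sub_zero, abs_of_nonneg (hs _)]
  linarith

/-! ### The nearest fixed point and approximate fixed points -/

section NearestFixedPoint

variable {X : Type*} [MetricSpace X] [CAT0Space X]

/-- The midpoint of two approximate fixed points of a nonexpansive map is an approximate fixed
point. -/
theorem dist_midpoint_apply_sq_le {C : Set X} (hC : GeoConvex C) {T : X → X}
    (hTne : ∀ x ∈ C, ∀ y ∈ C, dist (T x) (T y) ≤ dist x y) {ε : ℝ} {x y : X} (hx : x ∈ C)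
    (hy : y ∈ C) (hxε : dist x (T x) ≤ ε) (hyε : dist y (T y) ≤ ε) :
    dist (geoComb x y (1 / 2)) (T (geoComb x y (1 / 2))) ^ 2 ≤ dist x y * ε + ε ^ 2 := by
  have ht : (1 / 2 : ℝ) ∈ Set.Icc (0 : ℝ) 1 := by constructor <;> norm_num
  have hm := hC.2 x hx y hy _ ht
  set m := geoComb x y (1 / 2) with hmdef
  have h1 : dist x (T m) ≤ ε + dist x y / 2 := by
    have := dist_triangle x (T x) (T m)
    have := hTne x hx m hm
    have := dist_left_geoComb x y ht
    rw [← hmdef] at this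
    linarith
  have h2 : dist y (T m) ≤ ε + dist x y / 2 := by
    have := dist_triangle y (T y) (T m)
    have := hTne y hy m hm
    have := dist_geoComb_right x y ht
    rw [← hmdef, dist_comm] at this
    linarith
  have h3 := dist_geoComb_sq_le x y (T m) ht
  have h4 := pow_le_pow_left₀ dist_nonneg h1 2
  have h5 := pow_le_pow_left₀ dist_nonneg h2 2
  nlinarith

/-- Among the approximate fixed points of a nonexpansive map, those asymptotically closest to `u`
accumulate at a single fixed point `p`, and no approximate fixed points stay closer to `u` than
`p`. -/
theorem exists_fixedPoint_forall_approx [CompleteSpace X] {C : Set X} (hC : GeoConvex C)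
    (hCclosed : IsClosed C) {T : X → X}
    (hTne : ∀ x ∈ C, ∀ y ∈ C, dist (T x) (T y) ≤ dist x y)
    (hFix : ∃ p ∈ C, T p = p) (u : X) :
    ∃ p ∈ C, T p = p ∧ ∀ η > 0, ∃ ε > 0, ∀ x ∈ C, dist x (T x) ≤ ε →
      dist u p - η ≤ dist u x := by
  obtain ⟨q, hq, hTq⟩ := hFix
  -- `D` consists of the asymptotic lower bounds for `dist u` on approximate fixed points
  let D : Set ℝ := {r | ∃ ε > 0, ∀ x ∈ C, dist x (T x) ≤ ε → r ≤ dist u x}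
  have hD0 : (0 : ℝ) ∈ D := ⟨1, one_pos, fun _ _ _ => dist_nonneg⟩
  have hDb : BddAbove D := ⟨dist u q, fun r ⟨ε, hε, h⟩ => h q hq (by simpa [hTq] using hε.le)⟩
  set δ := sSup D with hδ
  have hδ0 : 0 ≤ δ := le_csSup hDb hD0
  have hlow : ∀ η > 0, ∃ ε > 0, ∀ x ∈ C, dist x (T x) ≤ ε → δ - η ≤ dist u x := by
    intro η hη
    obtain ⟨r, ⟨ε, hε, h⟩, hr⟩ := exists_lt_of_lt_csSup ⟨0, hD0⟩ (sub_lt_self δ hη)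
    exact ⟨ε, hε, fun x hx hxε => hr.le.trans (h x hx hxε)⟩
  have hup : ∀ ε > 0, ∃ x ∈ C, dist x (T x) ≤ ε ∧ dist u x ≤ δ + ε := by
    intro ε hε
    by_contra! hcon
    have : δ + ε ∈ D := ⟨ε, hε, fun x hx hxε => (hcon x hx hxε).le⟩
    linarith [le_csSup hDb this]
  choose y hyC hyT hyu using fun n : ℕ => hup (1 / ((n : ℝ) + 1)) Nat.one_div_pos_of_nat
  have hanti : ∀ {N n : ℕ}, N ≤ n → 1 / ((n : ℝ) + 1) ≤ 1 / ((N : ℝ) + 1) := fun h =>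
    Nat.one_div_le_one_div h
  have hy1 : ∀ n, dist u (y n) ≤ δ + 1 := fun n => by
    have := hanti (Nat.zero_le n)
    have := hyu n
    norm_num at *
    linarith
  have hcauchy : CauchySeq y := by
    rw [Metric.cauchySeq_iff]
    intro e he
    have ht : (1 / 2 : ℝ) ∈ Set.Icc (0 : ℝ) 1 := by constructor <;> norm_num
    -- with `κ` the excess in `dist u`, uniform convexity gives `dist ^ 2 ≤ 8 * κ * (2 * δ + 1)`
    obtain ⟨κ, hκ0, hκ1, hκ⟩ : ∃ κ > 0, κ ≤ 1 ∧ 8 * κ * (2 * δ + 1) < e ^ 2 := by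
      refine ⟨min 1 (e ^ 2 / (16 * (2 * δ + 1))), by positivity, min_le_left _ _, ?_⟩
      have h1 := min_le_right 1 (e ^ 2 / (16 * (2 * δ + 1)))
      rw [le_div_iff₀ (by positivity)] at h1
      nlinarith [sq_pos_of_pos he]
    obtain ⟨ε, hε, hεlow⟩ := hlow κ hκ0
    obtain ⟨N, hN⟩ : ∃ N : ℕ, 1 / ((N : ℝ) + 1) < min κ (min 1 (ε ^ 2 / (2 * δ + 4))) :=
      exists_nat_one_div_lt (by positivity)
    refine ⟨N, fun m hm n hn => ?_⟩
    set τ := 1 / ((N : ℝ) + 1) with hτ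
    have hτ0 : 0 < τ := Nat.one_div_pos_of_nat
    have hτκ : τ < κ := hN.trans_le (min_le_left _ _)
    have hτ1 : τ < 1 := hN.trans_le ((min_le_right _ _).trans (min_le_left _ _))
    have hτε : τ < ε ^ 2 / (2 * δ + 4) := hN.trans_le ((min_le_right _ _).trans (min_le_right _ _))
    rw [lt_div_iff₀ (by positivity)] at hτε
    have hmid := dist_midpoint_apply_sq_le hC hTne (hyC m) (hyC n)
      ((hyT m).trans (hanti hm)) ((hyT n).trans (hanti hn))
    have hdist : dist (y m) (y n) ≤ 2 * δ + 2 := by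
      have := dist_triangle_left (y m) (y n) u
      linarith [hy1 m, hy1 n]
    have hmidε : dist (geoComb (y m) (y n) (1 / 2)) (T (geoComb (y m) (y n) (1 / 2))) ≤ ε := by
      refine abs_le_of_sq_le_sq' ?_ hε.le |>.2
      nlinarith
    have hlo := hεlow _ (hC.2 _ (hyC m) _ (hyC n) _ ht) hmidε
    have hcn := dist_geoComb_sq_le (y m) (y n) u ht
    rw [dist_comm _ u, dist_comm _ u, dist_comm _ u] at hcn
    have hum : dist u (y m) ≤ δ + κ := by linarith [hyu m, hanti hm]
    have hun : dist u (y n) ≤ δ + κ := by linarith [hyu n, hanti hn]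
    have h1 := pow_le_pow_left₀ dist_nonneg hum 2
    have h2 := pow_le_pow_left₀ dist_nonneg hun 2
    have h3 : δ ^ 2 - 2 * δ * κ ≤ dist u (geoComb (y m) (y n) (1 / 2)) ^ 2 := by
      rcases le_total 0 (δ - κ) with hpos | hneg
      · nlinarith [pow_le_pow_left₀ hpos hlo 2]
      · nlinarith [sq_nonneg (dist u (geoComb (y m) (y n) (1 / 2)))]
    refine abs_lt_of_sq_lt_sq' ?_ he.le |>.2
    nlinarith
  obtain ⟨p, hp⟩ := cauchySeq_tendsto_of_complete hcauchy
  have hpC : p ∈ C := hCclosed.mem_of_tendsto hp (Eventually.of_forall hyC)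
  have hzero : Tendsto (fun n : ℕ => 1 / ((n : ℝ) + 1)) atTop (𝓝 0) :=
    tendsto_one_div_add_atTop_nhds_zero_nat
  have hdp : Tendsto (fun n => dist p (y n)) atTop (𝓝 0) := by
    simpa using (tendsto_const_nhds (x := p)).dist hp
  have hTp : T p = p := by
    have h1 : Tendsto (fun n : ℕ => 2 * dist p (y n) + 1 / ((n : ℝ) + 1)) atTop (𝓝 0) := by
      simpa using (hdp.const_mul 2).add hzero
    have h2 : dist p (T p) ≤ 0 := ge_of_tendsto' h1 fun n => by
      have e1 := dist_triangle4 p (y n) (T (y n)) (T p)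
      have e2 := hTne _ (hyC n) p hpC
      rw [dist_comm (y n) p] at e2
      linarith [hyT n]
    exact (dist_le_zero.1 h2).symm
  have hup' : dist u p ≤ δ := by
    have h1 : Tendsto (fun n : ℕ => δ + 1 / ((n : ℝ) + 1)) atTop (𝓝 δ) := by
      simpa using hzero.const_add δ
    exact le_of_tendsto_of_tendsto' (tendsto_const_nhds.dist hp) h1 hyu
  refine ⟨p, hpC, hTp, fun η hη => ?_⟩
  obtain ⟨ε, hε, h⟩ := hlow η hη
  exact ⟨ε, hε, fun x hx hxε => by linarith [h x hx hxε]⟩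

end NearestFixedPoint

/-! ### The Tikhonov–Mann iteration -/

section Iteration

variable {X : Type*} [MetricSpace X] [CAT0Space X] {C : Set X} {T : X → X} {β l : ℕ → ℝ}
  {u x₀ : X}

theorem tikhonovMann_mem (hC : GeoConvex C) (hT : Set.MapsTo T C C)
    (hβ : ∀ n, β n ∈ Set.Icc (0 : ℝ) 1) (hl : ∀ n, l n ∈ Set.Icc (0 : ℝ) 1)
    (hu : u ∈ C) (hx₀ : x₀ ∈ C) (n : ℕ) : tikhonovMann T β l u x₀ n ∈ C := by
  induction n with
  | zero => exact hx₀
  | succ n ih =>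
    have h := hC.2 u hu _ ih _ (hβ n)
    exact hC.2 _ h _ (hT h) _ (hl n)

theorem dist_geoComb_apply_fixedPoint_le
    (hTne : ∀ x ∈ C, ∀ y ∈ C, dist (T x) (T y) ≤ dist x y) {x p : X} (hx : x ∈ C) (hp : p ∈ C)
    (hTp : T p = p) {t : ℝ} (ht : t ∈ Set.Icc (0 : ℝ) 1) :
    dist (geoComb x (T x) t) p ≤ dist x p := by
  have h1 := dist_geoComb_le_right x (T x) p ht
  have h2 := hTne x hx p hp
  rw [hTp] at h2
  nlinarith [mul_le_mul_of_nonneg_left h2 ht.1]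

theorem dist_tikhonovMann_fixedPoint_le (hC : GeoConvex C) (hT : Set.MapsTo T C C)
    (hTne : ∀ x ∈ C, ∀ y ∈ C, dist (T x) (T y) ≤ dist x y)
    (hβ : ∀ n, β n ∈ Set.Icc (0 : ℝ) 1) (hl : ∀ n, l n ∈ Set.Icc (0 : ℝ) 1)
    (hu : u ∈ C) (hx₀ : x₀ ∈ C) {q : X} (hq : q ∈ C) (hTq : T q = q) (n : ℕ) :
    dist (tikhonovMann T β l u x₀ n) q ≤ max (dist u q) (dist x₀ q) := by
  induction n with
  | zero => exact le_max_right _ _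
  | succ n ih =>
    have hm := tikhonovMann_mem hC hT hβ hl hu hx₀ n
    refine (dist_geoComb_apply_fixedPoint_le hTne (hC.2 u hu _ hm _ (hβ n)) hq hTq (hl n)).trans ?_
    refine (dist_geoComb_le_right _ _ q (hβ n)).trans ?_
    have e1 := mul_le_mul_of_nonneg_left ih (hβ n).1
    have e2 := mul_le_mul_of_nonneg_left (le_max_left (dist u q) (dist x₀ q))
      (sub_nonneg.2 (hβ n).2)
    linarith

/-- Consecutive steps of the iteration contract by `β (n + 1)`, up to the variation of the
parameters. -/
theorem dist_tikhonovMann_succ_succ_le (hC : GeoConvex C) (hT : Set.MapsTo T C C)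
    (hTne : ∀ x ∈ C, ∀ y ∈ C, dist (T x) (T y) ≤ dist x y)
    (hβ : ∀ n, β n ∈ Set.Icc (0 : ℝ) 1) (hl : ∀ n, l n ∈ Set.Icc (0 : ℝ) 1)
    (hu : u ∈ C) (hx₀ : x₀ ∈ C) (n : ℕ) :
    let x := tikhonovMann T β l u x₀
    let v := fun n => geoComb u (x n) (β n)
    dist (x (n + 2)) (x (n + 1)) ≤ β (n + 1) * dist (x (n + 1)) (x n) +
      (|β (n + 1) - β n| * dist u (x n) + |l (n + 1) - l n| * dist (v n) (T (v n))) := by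
  intro x v
  have hx : ∀ n, x n ∈ C := tikhonovMann_mem hC hT hβ hl hu hx₀
  have hv : ∀ n, v n ∈ C := fun n => hC.2 u hu _ (hx n) _ (hβ n)
  have h1 : dist (v (n + 1)) (v n) ≤
      β (n + 1) * dist (x (n + 1)) (x n) + |β (n + 1) - β n| * dist u (x n) := by
    refine (dist_triangle _ (geoComb u (x n) (β (n + 1))) _).trans (add_le_add ?_ ?_)
    · exact dist_geoComb_le_of_left_eq _ _ _ (hβ _)
    · exact (dist_geoComb_geoComb _ _ (hβ _) (hβ _)).le
  have h2 : dist (x (n + 2)) (x (n + 1)) ≤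
      dist (v (n + 1)) (v n) + |l (n + 1) - l n| * dist (v n) (T (v n)) := by
    refine (dist_triangle _ (geoComb (v n) (T (v n)) (l (n + 1))) _).trans (add_le_add ?_ ?_)
    · refine (dist_geoComb_le (v (n + 1)) (T (v (n + 1))) _ _ (hl (n + 1))).trans ?_
      have e := mul_le_mul_of_nonneg_left (hTne _ (hv (n + 1)) _ (hv n)) (hl (n + 1)).1
      linarith
    · exact (dist_geoComb_geoComb _ _ (hl _) (hl _)).le
  linarith

/-- The iterates are asymptotically fixed by `T`. -/
theorem tendsto_dist_tikhonovMann_apply (hC : GeoConvex C) (hT : Set.MapsTo T C C)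
    (hTne : ∀ x ∈ C, ∀ y ∈ C, dist (T x) (T y) ≤ dist x y) (hFix : ∃ p ∈ C, T p = p)
    (hβ : ∀ n, β n ∈ Set.Icc (0 : ℝ) 1) (hl : ∀ n, l n ∈ Set.Icc (0 : ℝ) 1)
    (C1 : Tendsto (fun N => ∑ n ∈ Finset.range N, (1 - β n)) atTop atTop)
    (C2 : Summable fun n => |β (n + 1) - β n|) (C3 : Summable fun n => |l (n + 1) - l n|)
    (C4 : Tendsto β atTop (𝓝 1)) (C5 : 0 < liminf l atTop) (hu : u ∈ C) (hx₀ : x₀ ∈ C) :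
    Tendsto (fun n => dist (tikhonovMann T β l u x₀ n) (T (tikhonovMann T β l u x₀ n)))
      atTop (𝓝 0) := by
  obtain ⟨q, hq, hTq⟩ := hFix
  set x := tikhonovMann T β l u x₀ with hxdef
  set v := fun n => geoComb u (x n) (β n) with hvdef
  have hx : ∀ n, x n ∈ C := tikhonovMann_mem hC hT hβ hl hu hx₀
  have hv : ∀ n, v n ∈ C := fun n => hC.2 u hu _ (hx n) _ (hβ n)
  have hsucc : ∀ n, x (n + 1) = geoComb (v n) (T (v n)) (l n) := fun n => rfl
  set M := max (dist u q) (dist x₀ q)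
  have hxM : ∀ n, dist (x n) q ≤ M :=
    dist_tikhonovMann_fixedPoint_le hC hT hTne hβ hl hu hx₀ hq hTq
  have huM : dist u q ≤ M := le_max_left _ _
  have hux : ∀ n, dist u (x n) ≤ 2 * M := fun n => by
    linarith [dist_triangle_right u (x n) q, hxM n]
  have hvT : ∀ n, dist (v n) (T (v n)) ≤ 2 * M := fun n => by
    have e1 := dist_geoComb_le_right u (x n) q (hβ n)
    have e2 := hTne _ (hv n) q hq
    rw [hTq] at e2
    have e3 := mul_le_mul_of_nonneg_left (hxM n) (hβ n).1
    have e4 := mul_le_mul_of_nonneg_left huM (sub_nonneg.2 (hβ n).2)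
    have e5 : dist (v n) q ≤ M := by change dist (geoComb u (x n) (β n)) q ≤ M; linarith
    linarith [dist_triangle_right (v n) (T (v n)) q]
  have hreg : Tendsto (fun n => dist (x (n + 1)) (x n)) atTop (𝓝 0) := by
    have hsum : Tendsto (fun N => ∑ n ∈ Finset.range N, (1 - β (n + 1))) atTop atTop := by
      have h1 := (tendsto_add_atTop_iff_nat
        (f := fun N => ∑ n ∈ Finset.range N, (1 - β n)) 1).2 C1
      refine (tendsto_atTop_add_const_right _ (-(1 - β 0)) h1).congr fun N => ?_
      rw [Finset.sum_range_succ']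
      ring
    refine tendsto_zero_of_le_one_sub_mul_add (a := fun n => 1 - β (n + 1)) (b := fun _ => 0)
      (c := fun n => 2 * M * |β (n + 1) - β n| + 2 * M * |l (n + 1) - l n|)
      (fun _ => dist_nonneg) (fun n => ⟨sub_nonneg.2 (hβ _).2, by linarith [(hβ (n + 1)).1]⟩) hsum
      (fun η hη => Eventually.of_forall fun _ => hη.le) (fun n => ?_)
      ((C2.mul_left _).add (C3.mul_left _)) fun n => ?_
    · have : 0 ≤ M := le_trans dist_nonneg huM
      positivity
    · have h := dist_tikhonovMann_succ_succ_le hC hT hTne hβ hl hu hx₀ n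
      have e1 := mul_le_mul_of_nonneg_left (hux n) (abs_nonneg (β (n + 1) - β n))
      have e2 := mul_le_mul_of_nonneg_left (hvT n) (abs_nonneg (l (n + 1) - l n))
      simp only [← hxdef] at h
      change _ ≤ _ + (_ + _ * dist (v n) (T (v n))) at h
      simp only [sub_sub_cancel, mul_zero, add_zero]
      change dist (x (n + 2)) (x (n + 1)) ≤ _
      linarith
  have hxv : Tendsto (fun n => dist (x n) (v n)) atTop (𝓝 0) := by
    have h1 : Tendsto (fun n => (1 - β n) * (2 * M)) atTop (𝓝 0) := by
      simpa using (C4.const_sub 1).mul_const (2 * M)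
    refine squeeze_zero (fun _ => dist_nonneg) (fun n => ?_) h1
    rw [dist_comm]
    change dist (geoComb u (x n) (β n)) (x n) ≤ _
    rw [dist_geoComb_right _ _ (hβ n)]
    exact mul_le_mul_of_nonneg_left (hux n) (sub_nonneg.2 (hβ n).2)
  -- `l n` is eventually bounded below, and `dist (v n) (x (n + 1)) = l n * dist (v n) (T (v n))`
  have hvT0 : Tendsto (fun n => dist (v n) (T (v n))) atTop (𝓝 0) := by
    obtain ⟨r, hr0, hr⟩ := exists_between C5
    have hev := eventually_lt_of_lt_liminf hr
      (isBoundedUnder_of ⟨0, fun n => (hl n).1⟩)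
    have h1 : Tendsto (fun n => (dist (x n) (v n) + dist (x (n + 1)) (x n)) / r) atTop (𝓝 0) := by
      simpa using (hxv.add hreg).div_const r
    refine squeeze_zero' (Eventually.of_forall fun _ => dist_nonneg) ?_ h1
    filter_upwards [hev] with n hn
    rw [le_div_iff₀ hr0]
    have e1 := dist_left_geoComb (v n) (T (v n)) (hl n)
    rw [← hsucc] at e1
    have e2 := dist_triangle (v n) (x n) (x (n + 1))
    rw [dist_comm (v n) (x n), dist_comm (x n) (x (n + 1))] at e2
    have e3 := mul_le_mul_of_nonneg_right hn.le (dist_nonneg (x := v n) (y := T (v n)))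
    linarith
  have h1 : Tendsto (fun n => 2 * dist (x n) (v n) + dist (v n) (T (v n))) atTop (𝓝 0) := by
    simpa using (hxv.const_mul 2).add hvT0
  refine squeeze_zero (fun _ => dist_nonneg) (fun n => ?_) h1
  have e1 := dist_triangle4 (x n) (v n) (T (v n)) (T (x n))
  have e2 := hTne _ (hv n) _ (hx n)
  rw [dist_comm (v n) (x n)] at e2
  linarith

end Iteration

theorem mainTheorem10 {X : Type*} [MetricSpace X] [CAT0Space X] [CompleteSpace X]
    (C : Set X) (hC : GeoConvex C) (hCclosed : IsClosed C)
    (T : X → X) (hT : Set.MapsTo T C C)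
    (hTne : ∀ x ∈ C, ∀ y ∈ C, dist (T x) (T y) ≤ dist x y)
    (hFix : ∃ p ∈ C, T p = p)
    (β l : ℕ → ℝ) (hβ : ∀ n, β n ∈ Set.Icc (0 : ℝ) 1) (hl : ∀ n, l n ∈ Set.Icc (0 : ℝ) 1)
    (C1 : Tendsto (fun N => ∑ n ∈ Finset.range N, (1 - β n)) atTop atTop)
    (C2 : Summable fun n => |β (n + 1) - β n|)
    (C3 : Summable fun n => |l (n + 1) - l n|)
    (C4 : Tendsto β atTop (𝓝 1))
    (C5 : 0 < liminf l atTop)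
    (u x₀ : X) (hu : u ∈ C) (hx₀ : x₀ ∈ C) :
    ∃ p ∈ C, T p = p ∧ (∀ q ∈ C, T q = q → dist u p ≤ dist u q) ∧
      Tendsto (tikhonovMann T β l u x₀) atTop (𝓝 p) := by
  obtain ⟨p, hp, hTp, happ⟩ := exists_fixedPoint_forall_approx hC hCclosed hTne hFix u
  refine ⟨p, hp, hTp, fun q hq hTq => ?_, ?_⟩
  · refine le_of_forall_pos_sub_le fun η hη => ?_
    obtain ⟨ε, hε, h⟩ := happ η hη
    exact h q hq (by simpa [hTq] using hε.le)
  have hreg := tendsto_dist_tikhonovMann_apply hC hT hTne hFix hβ hl C1 C2 C3 C4 C5 hu hx₀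
  set x := tikhonovMann T β l u x₀ with hxdef
  have hx : ∀ n, x n ∈ C := tikhonovMann_mem hC hT hβ hl hu hx₀
  have hsq : Tendsto (fun n => dist (x n) p ^ 2) atTop (𝓝 0) := by
    refine tendsto_zero_of_le_one_sub_mul_add (a := fun n => 1 - β n)
      (b := fun n => dist u p ^ 2 - β n * dist u (x n) ^ 2) (c := fun _ => 0)
      (fun _ => sq_nonneg _) (fun n => ⟨sub_nonneg.2 (hβ n).2, by linarith [(hβ n).1]⟩) C1
      (fun η hη => ?_) (fun _ => le_rfl) summable_zero fun n => ?_
    · have hd : 0 ≤ dist u p := dist_nonneg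
      set d := dist u p with hddef
      -- if `d - κ ≤ dist u (x n)`, then `d ^ 2 - β n * dist u (x n) ^ 2` is at most
      -- `2 * d * κ + (1 - β n) * d ^ 2`
      obtain ⟨κ, hκ0, hκ⟩ : ∃ κ > 0, 2 * d * κ ≤ η / 2 := by
        refine ⟨η / (4 * (d + 1)), by positivity, ?_⟩
        rw [mul_div_assoc', div_le_iff₀ (by positivity)]
        nlinarith
      obtain ⟨ε, hε, h⟩ := happ κ hκ0
      have hβlim : Tendsto (fun n => (1 - β n) * d ^ 2) atTop (𝓝 0) := by
        simpa using (C4.const_sub 1).mul_const (d ^ 2)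
      filter_upwards [hreg.eventually (ge_mem_nhds hε),
        hβlim.eventually (ge_mem_nhds (half_pos hη))] with n hn hn'
      have hlo := h (x n) (hx n) hn
      have h3 : d ^ 2 - 2 * d * κ ≤ dist u (x n) ^ 2 := by
        rcases le_total 0 (d - κ) with hpos | hneg
        · nlinarith [pow_le_pow_left₀ hpos hlo 2]
        · nlinarith [sq_nonneg (dist u (x n))]
      have h4 := mul_le_mul_of_nonneg_left h3 (hβ n).1
      have h5 : β n * (2 * d * κ) ≤ 2 * d * κ :=
        mul_le_of_le_one_left (by positivity) (hβ n).2
      linarith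
    · have e1 := dist_geoComb_apply_fixedPoint_le hTne (hC.2 u hu _ (hx n) _ (hβ n)) hp hTp (hl n)
      have e2 := pow_le_pow_left₀ dist_nonneg e1 2
      have e3 := dist_geoComb_sq_le u (x n) p (hβ n)
      change dist (x (n + 1)) p ^ 2 ≤ _ at e2
      linarith
  rw [tendsto_iff_dist_tendsto_zero]
  have h := hsq.sqrt
  simpa [Real.sqrt_sq dist_nonneg] using h
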